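/- All graphs are finite, simple and undirected. Let $G$ be a graph, and color each of its vertices blue or white. The color change rule allows a blue vertex $u$ to turn a white vertex $w$ blue if $w$ is the only white neighbor of $u$. A set $B\subseteq V(G)$ is a zero forcing set of $G$ if, starting with exactly the vertices of $B$ blue, repeated application of the rule can color every vertex blue. The zero forcing number $\operatorname{Z}(G)$ is the minimum of $|B|$ over all zero forcing sets $B$ of $G$, and a zero forcing set with $|B|=\operatorname{Z}(G)$ is called a minimum zero forcing set. The zero forcing graph $\mathscr{Z}(G)$ is the graph whose vertices are the minimum zero forcing sets of $G$, where $B$ and $B'$ are adjacent if and only if one is obtained from the other by changing a single vertex, i.e. the symmetric difference of $B$ and $B'$ has exactly two elements. The Cartesian product $G\,\Box\,G'$ is the graph with vertex set $V(G)\times V(G')$ in which $(v,v')$ and $(u,u')$ are adjacent if and only if $v=u$ and $v'u'\in E(G')$, or $v'=u'$ and $vu\in E(G)$. (1) For every tree $T$, the graph $\mathscr{Z}(T)$ is connected. (2) For every forest $T$, the graph $\mathscr{Z}(T)$ is connected. (3) For any two graphs $G_1$ and $G_2$, we have $\mathscr{Z}(G_1\sqcup G_2)\cong\mathscr{Z}(G_1)\,\Box\,\mathscr{Z}(G_2)$,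 where $G_1\sqcup G_2$ is the disjoint union; an isomorphism from the product is given by $(X,Y)\mapsto X\sqcup Y$. -/

import Mathlib

namespace ZeroForcing

variable {V : Type*} [Fintype V] [DecidableEq V]

/-- With `B` the set of blue vertices, the blue vertex `u` can change the color of the white
vertex `w` to blue: `w` is the unique white neighbor of `u`. -/
def Forces (G : SimpleGraph V) (B : Finset V) (u w : V) : Prop :=
  u ∈ B ∧ w ∉ B ∧ G.Adj u w ∧ ∀ x, G.Adj u x → x ∉ B → x = w

/-- One application of the color change rule turns the set `B` of blue vertices into `C`. -/
def Step (G : SimpleGraph V) (B C : Finset V) : Prop :=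
  ∃ u w, Forces G B u w ∧ C = insert w B

/-- `B` is a zero forcing set: starting with `B` blue, finitely many applications of the color
change rule color all vertices blue. -/
def IsZeroForcing (G : SimpleGraph V) (B : Finset V) : Prop :=
  Relation.ReflTransGen (Step G) B Finset.univ

/-- The zero forcing number: the minimum cardinality of a zero forcing set. (The set of all
vertices is zero forcing, so the infimum is over a nonempty set.) -/
noncomputable def zeroForcingNumber (G : SimpleGraph V) : ℕ :=
  sInf {k | ∃ B : Finset V, IsZeroForcing G B ∧ B.card = k}

/-- Minimum zero forcing sets. -/
def IsMinZeroForcing (G : SimpleGraph V) (B : Finset V) : Prop :=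
  IsZeroForcing G B ∧ B.card = zeroForcingNumber G

/-- The zero forcing graph of `G`: its vertices are the minimum zero forcing sets of `G`, and two
of them are adjacent when their symmetric difference has exactly two elements, that is (the sets
having the same cardinality), when one is obtained from the other by changing a single vertex. -/
def zeroForcingGraph (G : SimpleGraph V) : SimpleGraph {B : Finset V // IsMinZeroForcing G B} where
  Adj X Y := (symmDiff X.1 Y.1).card = 2
  symm := ⟨fun X Y h => by rw [symmDiff_comm]; exact h⟩
  loopless := ⟨fun X h => by simp at h⟩

end ZeroForcing

namespace ZeroForcing

open Finset Relation

variable {V : Type*}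

/-! In a forest, the zero forcing sets are exactly the sets of initial vertices of oriented covers
by disjoint paths (single vertices allowed). The forces of a run form such a cover
(`IsZeroForcing.exists_isPathSystem`). Conversely, every orientation of every cover forces the whole
forest from its sources, since a stalled run would yield an endless walk without backtracking
(`IsPathSystem.isZeroForcing_sources`). The number of sources is the number of vertices minus the
number of edges used, so minimum sets come from covers with the most edges.

Reversing one path moves at most one source, so it is an edge of the zero forcing graph or no move
at all. This joins any two orientations of the same cover. If the covers `D`, `D'` differ, the edges
in exactly one of them form a forest, which has a leaf `l` on an edge `lp`, say of `D'`. Then `l` is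
an endpoint in `D`, minimality makes `p` interior in `D`, and some edge `pq` of `D` is not in `D'`.
After reversals, `q → p` can be replaced by `l → p` with the same sources, which brings `D` closer
to `D'`.

In a disjoint union no force crosses between the summands, so minimum sets split; a parity argument
identifies the adjacencies. -/

/-- A finite forest has no nonempty set of darts in which every dart can be continued without
backtracking. -/
theorem not_of_nonbacktracking [Fintype V] {T : SimpleGraph V} (hT : T.IsAcyclic)
    {S : V → V → Prop} (hS : ∀ u v, S u v → T.Adj u v)
    (hnext : ∀ u v, S u v → ∃ w, S v w ∧ w ≠ u) (u v : V) : ¬ S u v := by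
  intro huv
  have key : ∀ n : ℕ, ∃ (a b : V) (p : T.Walk a b), p.IsPath ∧ p.length = n + 1 ∧
      S p.penultimate b := by
    intro n
    induction n with
    | zero =>
      have h := hS u v huv
      refine ⟨u, v, h.toWalk, ?_, rfl, huv⟩
      simp [SimpleGraph.Walk.isPath_def, h.ne]
    | succ n ih =>
      obtain ⟨a, b, p, hp, hl, hs⟩ := ih
      obtain ⟨w, hw, hne⟩ := hnext _ _ hs
      have hadj := hS _ _ hw
      -- In a forest, the only neighbor of the end of a path that lies on the path is the
      -- penultimate vertex.
      have hns : w ∉ p.support := fun h => hne (hT.eq_penultimate_of_adj_end hp hadj h)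
      refine ⟨a, w, p.concat hadj, hp.concat hns hadj, by simp [hl], ?_⟩
      simpa [SimpleGraph.Walk.penultimate_concat] using hw
  obtain ⟨a, b, p, hp, hl, -⟩ := key (Fintype.card V)
  have := hp.length_lt
  omega

/-! ### Minimum sets and parity -/

theorem exists_isMinZeroForcing [Fintype V] [DecidableEq V] (G : SimpleGraph V) :
    ∃ B, IsMinZeroForcing G B := by
  have : (zeroForcingNumber G) ∈ {k | ∃ B : Finset V, IsZeroForcing G B ∧ B.card = k} :=
    Nat.sInf_mem ⟨_, univ, ReflTransGen.refl, rfl⟩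
  exact this

theorem zeroForcingNumber_le [Fintype V] [DecidableEq V] {G : SimpleGraph V} {B : Finset V}
    (h : IsZeroForcing G B) : zeroForcingNumber G ≤ B.card :=
  Nat.sInf_le ⟨B, h, rfl⟩

/-- Used for the product: two even cardinalities add up to 2 only as 0 + 2 or 2 + 0, so exactly one
coordinate changes. -/
theorem even_card_symmDiff {α : Type*} [DecidableEq α] {s t : Finset α} (h : s.card = t.card) :
    Even (symmDiff s t).card := by
  have h1 : (symmDiff s t).card = (s \ t).card + (t \ s).card := by
    rw [symmDiff_def, sup_eq_union, card_union_of_disjoint]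
    exact disjoint_sdiff_sdiff
  have := card_sdiff_add_card_inter s t
  have := card_sdiff_add_card_inter t s
  rw [inter_comm] at this
  exact ⟨(s \ t).card, by omega⟩

/-! ### Disjoint unions -/

section Sum

variable {W : Type*} [DecidableEq V] [DecidableEq W]
  {G : SimpleGraph V} {H : SimpleGraph W}

/-- No edge joins the two sides, so a force on the right leaves the left part fixed; hence the
reflexive closure. -/
theorem Step.toLeft {B C : Finset (V ⊕ W)} (h : Step (G.sum H) B C) :
    ReflTransGen (Step G) B.toLeft C.toLeft := by
  obtain ⟨u, w, ⟨hu, hw, hadj, hx⟩, rfl⟩ := h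
  rcases u with u | u <;> rcases w with w | w
  · refine .single ⟨u, w, ⟨by simpa, by simpa, by simpa using hadj, fun x h1 h2 => ?_⟩, by simp⟩
    simpa using hx (.inl x) (by simpa) (by simpa using h2)
  · simp [SimpleGraph.sum] at hadj
  · simp [SimpleGraph.sum] at hadj
  · simpa using ReflTransGen.refl

theorem Step.toRight {B C : Finset (V ⊕ W)} (h : Step (G.sum H) B C) :
    ReflTransGen (Step H) B.toRight C.toRight := by
  obtain ⟨u, w, ⟨hu, hw, hadj, hx⟩, rfl⟩ := h
  rcases u with u | u <;> rcases w with w | w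
  · simpa using ReflTransGen.refl
  · simp [SimpleGraph.sum] at hadj
  · simp [SimpleGraph.sum] at hadj
  · refine .single ⟨u, w, ⟨by simpa, by simpa, by simpa using hadj, fun x h1 h2 => ?_⟩, by simp⟩
    simpa using hx (.inr x) (by simpa) (by simpa using h2)

theorem Step.disjSum_left {B C : Finset V} (h : Step G B C) (Y : Finset W) :
    Step (G.sum H) (B.disjSum Y) (C.disjSum Y) := by
  obtain ⟨u, w, ⟨hu, hw, hadj, hx⟩, rfl⟩ := h
  refine ⟨.inl u, .inl w, ⟨by simpa, by simpa, by simpa, ?_⟩, ?_⟩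
  · rintro (x | x) h1 h2
    · simpa using hx x (by simpa using h1) (by simpa using h2)
    · simp [SimpleGraph.sum] at h1
  · ext (x | x) <;> simp

theorem Step.disjSum_right {B C : Finset W} (h : Step H B C) (X : Finset V) :
    Step (G.sum H) (X.disjSum B) (X.disjSum C) := by
  obtain ⟨u, w, ⟨hu, hw, hadj, hx⟩, rfl⟩ := h
  refine ⟨.inr u, .inr w, ⟨by simpa, by simpa, by simpa, ?_⟩, ?_⟩
  · rintro (x | x) h1 h2
    · simp [SimpleGraph.sum] at h1
    · simpa using hx x (by simpa using h1) (by simpa using h2)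
  · ext (x | x) <;> simp

theorem symmDiff_disjSum (X X' : Finset V) (Y Y' : Finset W) :
    symmDiff (X.disjSum Y) (X'.disjSum Y') = (symmDiff X X').disjSum (symmDiff Y Y') := by
  ext (x | x) <;> simp [mem_symmDiff]

variable [Fintype V] [Fintype W]

theorem isZeroForcing_disjSum {X : Finset V} {Y : Finset W} :
    IsZeroForcing (G.sum H) (X.disjSum Y) ↔ IsZeroForcing G X ∧ IsZeroForcing H Y := by
  constructor
  · intro h
    refine ⟨?_, ?_⟩
    · have := ReflTransGen.lift' (fun B : Finset (V ⊕ W) => B.toLeft)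
        (fun _ _ h => Step.toLeft h) _ _ h
      have e : (univ : Finset (V ⊕ W)).toLeft = univ := by ext; simp
      simpa [IsZeroForcing, Function.onFun, e] using this
    · have := ReflTransGen.lift' (fun B : Finset (V ⊕ W) => B.toRight)
        (fun _ _ h => Step.toRight h) _ _ h
      have e : (univ : Finset (V ⊕ W)).toRight = univ := by ext; simp
      simpa [IsZeroForcing, Function.onFun, e] using this
  · rintro ⟨hX, hY⟩
    have h1 : ReflTransGen (Step (G.sum H)) (X.disjSum Y) (univ.disjSum Y) :=
      ReflTransGen.lift (fun B : Finset V => B.disjSum Y) (fun _ _ h => h.disjSum_left Y) _ _ hX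
    have h2 : ReflTransGen (Step (G.sum H)) (univ.disjSum Y) (univ.disjSum univ) :=
      ReflTransGen.lift (fun B : Finset W => (univ : Finset V).disjSum B)
        (fun _ _ h => h.disjSum_right univ) _ _ hY
    have e : (univ : Finset V).disjSum (univ : Finset W) = univ := by ext (x | x) <;> simp
    rw [e] at h2
    exact h1.trans h2

theorem zeroForcingNumber_sum :
    zeroForcingNumber (G.sum H) = zeroForcingNumber G + zeroForcingNumber H := by
  apply le_antisymm
  · obtain ⟨X, hX, hX'⟩ := exists_isMinZeroForcing G
    obtain ⟨Y, hY, hY'⟩ := exists_isMinZeroForcing H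
    rw [← hX', ← hY', ← card_disjSum]
    exact zeroForcingNumber_le (isZeroForcing_disjSum.2 ⟨hX, hY⟩)
  · obtain ⟨B, hB, hB'⟩ := exists_isMinZeroForcing (G.sum H)
    rw [← toLeft_disjSum_toRight (u := B)] at hB
    have := isZeroForcing_disjSum.1 hB
    rw [← hB', ← card_toLeft_add_card_toRight]
    exact add_le_add (zeroForcingNumber_le this.1) (zeroForcingNumber_le this.2)

theorem isMinZeroForcing_disjSum {X : Finset V} {Y : Finset W} :
    IsMinZeroForcing (G.sum H) (X.disjSum Y) ↔ IsMinZeroForcing G X ∧ IsMinZeroForcing H Y := by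
  unfold IsMinZeroForcing
  rw [isZeroForcing_disjSum, zeroForcingNumber_sum, card_disjSum]
  constructor
  · rintro ⟨⟨hX, hY⟩, h⟩
    have := zeroForcingNumber_le hX
    have := zeroForcingNumber_le hY
    exact ⟨⟨hX, by omega⟩, hY, by omega⟩
  · rintro ⟨⟨hX, h⟩, hY, h'⟩
    exact ⟨⟨hX, hY⟩, by omega⟩

/-- Minimum zero forcing sets of a disjoint union are the disjoint unions of minimum zero forcing
sets. -/
def sumIso (G : SimpleGraph V) (H : SimpleGraph W) :
    (zeroForcingGraph G).boxProd (zeroForcingGraph H) ≃g zeroForcingGraph (G.sum H) where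
  toFun p := ⟨p.1.1.disjSum p.2.1, isMinZeroForcing_disjSum.2 ⟨p.1.2, p.2.2⟩⟩
  invFun B :=
    have h := isMinZeroForcing_disjSum.1 ((toLeft_disjSum_toRight (u := B.1)).symm ▸ B.2)
    (⟨B.1.toLeft, h.1⟩, ⟨B.1.toRight, h.2⟩)
  left_inv p := by simp
  right_inv B := by simp [toLeft_disjSum_toRight]
  map_rel_iff' := by
    rintro ⟨X, Y⟩ ⟨X', Y'⟩
    rw [SimpleGraph.boxProd_adj]
    change (symmDiff (X.1.disjSum Y.1) (X'.1.disjSum Y'.1)).card = 2 ↔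
      (symmDiff X.1 X'.1).card = 2 ∧ Y = Y' ∨ (symmDiff Y.1 Y'.1).card = 2 ∧ X = X'
    rw [symmDiff_disjSum, card_disjSum]
    obtain ⟨a, ha⟩ := even_card_symmDiff (X.2.2.trans X'.2.2.symm)
    obtain ⟨b, hb⟩ := even_card_symmDiff (Y.2.2.trans Y'.2.2.symm)
    have hX : X = X' ↔ (symmDiff X.1 X'.1).card = 0 := by
      rw [card_eq_zero, ← bot_eq_empty, symmDiff_eq_bot, Subtype.ext_iff]
    have hY : Y = Y' ↔ (symmDiff Y.1 Y'.1).card = 0 := by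
      rw [card_eq_zero, ← bot_eq_empty, symmDiff_eq_bot, Subtype.ext_iff]
    rw [hX, hY]
    omega

end Sum

/-! ### Path systems and zero forcing sets of forests -/

/-- An orientation of a collection of vertex-disjoint paths of `T` (when `T` is a forest):
`D u w` says that `w` follows `u`. -/
structure IsPathSystem (T : SimpleGraph V) (D : V → V → Prop) : Prop where
  adj {u w} : D u w → T.Adj u w
  out_unique {u w w'} : D u w → D u w' → w = w'
  in_unique {u u' w} : D u w → D u' w → u = u'
  asymm {u w} : D u w → ¬ D w u

open Classical in
/-- The initial vertices of the paths. -/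
noncomputable def sources [Fintype V] (D : V → V → Prop) : Finset V :=
  univ.filter fun w => ∀ u, ¬ D u w

/-- The undirected graph underlying `D`. -/
def Link (D : V → V → Prop) (u w : V) : Prop := D u w ∨ D w u

theorem Link.symm {D : V → V → Prop} {u w : V} (h : Link D u w) : Link D w u := Or.symm h

theorem mem_sources [Fintype V] {D : V → V → Prop} {w : V} :
    w ∈ sources D ↔ ∀ u, ¬ D u w := by
  simp [sources]

-- Each vertex that is not a source is the head of exactly one dart.
open Classical in
theorem IsPathSystem.card_sources_add [Fintype V] {T : SimpleGraph V} {D : V → V → Prop}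
    (hD : IsPathSystem T D) :
    (sources D).card + (univ.filter fun p : V × V => D p.1 p.2).card = Fintype.card V := by
  have h : (univ.filter fun p : V × V => D p.1 p.2).image Prod.snd = (sources D)ᶜ := by
    ext w
    simp [mem_sources]
  have hinj : Set.InjOn Prod.snd ((univ.filter fun p : V × V => D p.1 p.2) : Set (V × V)) := by
    rintro ⟨a, b⟩ hab ⟨c, d⟩ hcd (rfl : b = d)
    simp only [coe_filter, mem_univ, true_and, Set.mem_ofPred_eq] at hab hcd
    rw [hD.in_unique hab hcd]
  rw [← card_image_of_injOn hinj, h, card_add_card_compl]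

theorem IsPathSystem.isZeroForcing_sources [Fintype V] [DecidableEq V] {T : SimpleGraph V}
    (hT : T.IsAcyclic) {D : V → V → Prop} (hD : IsPathSystem T D) :
    IsZeroForcing T (sources D) := by
  suffices h : ∀ (n : ℕ) (C : Finset V), Cᶜ.card = n → sources D ⊆ C →
      (∀ u w, D u w → w ∈ C → u ∈ C) → IsZeroForcing T C by
    exact h _ _ rfl Subset.rfl fun u w huw hw => (mem_sources.1 hw u huw).elim
  intro n
  induction n with
  | zero =>
    intro C hC _ _
    rw [card_eq_zero, compl_eq_empty_iff] at hC
    rw [hC]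
    exact ReflTransGen.refl
  | succ n ih =>
    intro C hC hBC hinv
    obtain ⟨w₀, hw₀⟩ : Cᶜ.Nonempty := by
      rw [← card_pos]
      omega
    rw [mem_compl] at hw₀
    have hpred : ∀ w, w ∉ C → ∃ z, D z w := by
      intro w hw
      by_contra! h
      exact hw (hBC (mem_sources.2 h))
    by_cases hf : ∃ u w, D u w ∧ Forces T C u w
    · obtain ⟨u, w, huw, hF⟩ := hf
      have hcard : (insert w C)ᶜ.card = n := by
        rw [compl_insert, card_erase_of_mem (mem_compl.2 hF.2.1)]
        omega
      refine ReflTransGen.head ⟨u, w, hF, rfl⟩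
        (ih _ hcard (hBC.trans (subset_insert _ _)) fun a b hab hb => ?_)
      rcases mem_insert.1 hb with rfl | hb
      · rw [hD.in_unique hab huw]
        exact mem_insert_of_mem hF.1
      · exact mem_insert_of_mem (hinv a b hab hb)
    · exfalso
      push Not at hf
      obtain ⟨z₀, hz₀⟩ := hpred w₀ hw₀
      -- The endless walk: from a white vertex go to its predecessor. If that is blue, it cannot
      -- force its successor, so it has another white neighbor to move to.
      refine not_of_nonbacktracking hT
        (S := fun a b => (a ∉ C ∧ D b a) ∨ (b ∉ C ∧ T.Adj a b ∧ ¬ D a b)) ?_ ?_ w₀ z₀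
        (Or.inl ⟨hw₀, hz₀⟩)
      · rintro a b (⟨-, h⟩ | ⟨-, h, -⟩)
        · exact (hD.adj h).symm
        · exact h
      · rintro a b (⟨ha, h⟩ | ⟨hb, -, h⟩)
        · by_cases hb : b ∈ C
          · have := hf b a h
            simp only [Forces, hb, ha, hD.adj h, not_false_eq_true, true_and] at this
            push Not at this
            obtain ⟨x, hbx, hx, hxa⟩ := this
            exact ⟨x, Or.inr ⟨hx, hbx, fun hd => hxa (hD.out_unique hd h)⟩, hxa⟩
          · obtain ⟨c, hc⟩ := hpred b hb
            refine ⟨c, Or.inl ⟨hb, hc⟩, ?_⟩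
            rintro rfl
            exact hD.asymm h hc
        · obtain ⟨c, hc⟩ := hpred b hb
          refine ⟨c, Or.inl ⟨hb, hc⟩, ?_⟩
          rintro rfl
          exact h hc

/-- `D` records who forced whom. Once a vertex has forced, all its neighbors are blue, so it never
forces again; this is the last invariant. -/
theorem IsZeroForcing.exists_isPathSystem [Fintype V] [DecidableEq V] {T : SimpleGraph V}
    {B : Finset V} (hB : IsZeroForcing T B) : ∃ D, IsPathSystem T D ∧ sources D = B := by
  suffices h : ∀ C, ReflTransGen (Step T) B C → ∃ D, IsPathSystem T D ∧ B ⊆ C ∧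
      (∀ w, (∃ u, D u w) ↔ w ∈ C ∧ w ∉ B) ∧
      ∀ u w, D u w → u ∈ C ∧ ∀ x, T.Adj u x → x ∈ C by
    obtain ⟨D, hD, -, h, -⟩ := h _ hB
    refine ⟨D, hD, ?_⟩
    ext w
    have := h w
    rw [mem_sources, ← not_exists, this]
    simp
  intro C hC
  induction hC with
  | refl => exact ⟨fun _ _ => False, ⟨nofun, nofun, nofun, nofun⟩, Subset.rfl, by simp, nofun⟩
  | @tail C C' _ hstep ih =>
    obtain ⟨D, hD, hBC, hheads, htails⟩ := ih
    obtain ⟨u, w, ⟨hu, hw, hadj, huniq⟩, rfl⟩ := hstep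
    have hout : ∀ x, ¬ D u x := fun x hx => hw ((htails u x hx).2 w hadj)
    have hin : ∀ x, ¬ D x w := fun x hx => hw ((hheads w).1 ⟨x, hx⟩).1
    have hout' : ∀ x, ¬ D w x := fun x hx => hw (htails w x hx).1
    refine ⟨fun a b => D a b ∨ (a = u ∧ b = w), ⟨?_, ?_, ?_, ?_⟩,
      hBC.trans (subset_insert _ _), ?_, ?_⟩
    · rintro a b (h | ⟨rfl, rfl⟩)
      exacts [hD.adj h, hadj]
    · rintro a b c (h | ⟨rfl, rfl⟩) (h' | ⟨h1, h2⟩)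
      · exact hD.out_unique h h'
      · exact (hout b (h1 ▸ h)).elim
      · exact (hout c h').elim
      · exact h2.symm
    · rintro a b c (h | ⟨rfl, rfl⟩) (h' | ⟨h1, h2⟩)
      · exact hD.in_unique h h'
      · exact (hin a (h2 ▸ h)).elim
      · exact (hin b h').elim
      · exact h1.symm
    · rintro a b (h | ⟨rfl, rfl⟩) (h' | ⟨h1, h2⟩)
      · exact hD.asymm h h'
      · exact hout' b (h2 ▸ h)
      · exact hout' _ h'
      · exact hadj.ne h2
    · intro x
      simp only [exists_or, hheads, exists_eq_left, mem_insert]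
      constructor
      · rintro (⟨h1, h2⟩ | rfl)
        · exact ⟨Or.inr h1, h2⟩
        · exact ⟨Or.inl rfl, fun h => hw (hBC h)⟩
      · rintro ⟨rfl | h1, h2⟩
        · exact Or.inr rfl
        · exact Or.inl ⟨h1, h2⟩
    · rintro a b (h | ⟨rfl, rfl⟩)
      · obtain ⟨h1, h2⟩ := htails a b h
        exact ⟨mem_insert_of_mem h1, fun x hx => mem_insert_of_mem (h2 x hx)⟩
      · refine ⟨mem_insert_of_mem hu, fun x hx => ?_⟩
        by_contra hx'
        rw [mem_insert, not_or] at hx'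
        exact hx'.1 (huniq x hx hx'.2)

/-- Otherwise predecessors could be followed forever, without backtracking by `asymm`. -/
theorem IsPathSystem.exists_source [Fintype V] {T : SimpleGraph V} (hT : T.IsAcyclic)
    {D : V → V → Prop} (hD : IsPathSystem T D) (p : V) :
    ∃ b ∈ sources D, ReflTransGen D b p := by
  by_contra! h
  have hpred : ∀ b, ReflTransGen D b p → ∃ z, D z b := by
    intro b hb
    by_contra! h'
    exact h b (mem_sources.2 h') hb
  obtain ⟨z, hz⟩ := hpred p .refl
  refine not_of_nonbacktracking hT (S := fun v u => D u v ∧ ReflTransGen D u p)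
    (fun v u h => (hD.adj h.1).symm) ?_ p z ⟨hz, .single hz⟩
  rintro v u ⟨h1, h2⟩
  obtain ⟨x, hx⟩ := hpred u h2
  refine ⟨x, ⟨hx, .head hx h2⟩, ?_⟩
  rintro rfl
  exact hD.asymm h1 hx

theorem reflTransGen_link {D : V → V → Prop} {a b : V} (h : ReflTransGen D a b) :
    ReflTransGen (Link D) a b :=
  ReflTransGen.mono (fun _ _ h => Or.inl h) _ _ h

theorem reflTransGen_link_symm {D : V → V → Prop} {a b : V} (h : ReflTransGen (Link D) a b) :
    ReflTransGen (Link D) b a := by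
  induction h with
  | refl => exact .refl
  | tail _ h ih => exact .head h.symm ih

/-! ### Reversing one path -/

/-- Two minimum zero forcing sets of `T` lie in the same component of the zero forcing graph. -/
def Conn [Fintype V] [DecidableEq V] (T : SimpleGraph V) (B B' : Finset V) : Prop :=
  ∃ (h : IsMinZeroForcing T B) (h' : IsMinZeroForcing T B'),
    (zeroForcingGraph T).Reachable ⟨B, h⟩ ⟨B', h'⟩

/-- Reversing the path through `p`. -/
theorem IsPathSystem.exists_flip [Fintype V] [DecidableEq V] {T : SimpleGraph V}
    (hT : T.IsAcyclic) {D : V → V → Prop} (hD : IsPathSystem T D)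
    (hmin : IsMinZeroForcing T (sources D)) (p : V) :
    ∃ (D' : V → V → Prop) (K : Set V), IsPathSystem T D' ∧ Conn T (sources D) (sources D') ∧
      p ∈ K ∧ (∀ x ∈ K, ReflTransGen (Link D) p x) ∧
      (∀ x ∈ K, ∀ y, (D' x y ↔ D y x) ∧ (D' y x ↔ D x y)) ∧
      (∀ x ∉ K, ∀ y, (D' x y ↔ D x y) ∧ (D' y x ↔ D y x)) := by
  classical
  obtain ⟨b, hb, hbp⟩ := hD.exists_source hT p
  rw [mem_sources] at hb
  set K : Set V := {x | ReflTransGen D b x} with hKdef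
  have hK : ∀ u w, D u w → (u ∈ K ↔ w ∈ K) := by
    intro u w huw
    refine ⟨fun h => ReflTransGen.tail h huw, fun h => ?_⟩
    rcases ReflTransGen.cases_tail h with rfl | ⟨c, hc, hcw⟩
    · exact (hb u huw).elim
    · rwa [hD.in_unique huw hcw]
  obtain ⟨D', hD'def⟩ : ∃ D' : V → V → Prop, ∀ u w, D' u w = if u ∈ K then D w u else D u w :=
    ⟨_, fun _ _ => rfl⟩
  have hin : ∀ x ∈ K, ∀ y, (D' x y ↔ D y x) ∧ (D' y x ↔ D x y) := by
    intro x hx y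
    refine ⟨by simp [hD'def, hx], ?_⟩
    by_cases hy : y ∈ K
    · simp [hD'def, hy]
    · simp only [hD'def, hy, if_false]
      exact ⟨fun h => (hy ((hK _ _ h).2 hx)).elim, fun h => (hy ((hK _ _ h).1 hx)).elim⟩
  have hout : ∀ x ∉ K, ∀ y, (D' x y ↔ D x y) ∧ (D' y x ↔ D y x) := by
    intro x hx y
    refine ⟨by simp [hD'def, hx], ?_⟩
    by_cases hy : y ∈ K
    · simp only [hD'def, hy, if_true]
      exact ⟨fun h => (hx ((hK _ _ h).2 hy)).elim, fun h => (hx ((hK _ _ h).1 hy)).elim⟩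
    · simp [hD'def, hy]
  have hsys : IsPathSystem T D' := by
    refine ⟨?_, ?_, ?_, ?_⟩
    · intro u w h
      by_cases hu : u ∈ K
      · exact (hD.adj ((hin u hu w).1.1 h)).symm
      · exact hD.adj ((hout u hu w).1.1 h)
    · intro u w w' h h'
      by_cases hu : u ∈ K
      · exact hD.in_unique ((hin u hu w).1.1 h) ((hin u hu w').1.1 h')
      · exact hD.out_unique ((hout u hu w).1.1 h) ((hout u hu w').1.1 h')
    · intro w w' u h h'
      by_cases hu : u ∈ K
      · exact hD.out_unique ((hin u hu w).2.1 h) ((hin u hu w').2.1 h')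
      · exact hD.in_unique ((hout u hu w).2.1 h) ((hout u hu w').2.1 h')
    · intro u w h h'
      by_cases hu : u ∈ K
      · exact hD.asymm ((hin u hu w).1.1 h) ((hin u hu w).2.1 h')
      · exact hD.asymm ((hout u hu w).1.1 h) ((hout u hu w).2.1 h')
  have hcard : (sources D).card = (sources D').card := by
    have h1 := hD.card_sources_add
    have h2 := hsys.card_sources_add
    have h3 : (univ.filter fun p : V × V => D p.1 p.2).card =
        (univ.filter fun p : V × V => D' p.1 p.2).card := by
      refine card_nbij' (fun q => if q.1 ∈ K then q.swap else q)
        (fun q => if q.1 ∈ K then q.swap else q) ?_ ?_ ?_ ?_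
      · rintro ⟨u, w⟩ h
        simp only [coe_filter, mem_univ, true_and, Set.mem_ofPred_eq] at h ⊢
        by_cases hu : u ∈ K
        · simpa [hu] using (hin u hu w).2.2 h
        · simpa [hu] using (hout u hu w).1.2 h
      · rintro ⟨u, w⟩ h
        simp only [coe_filter, mem_univ, true_and, Set.mem_ofPred_eq] at h ⊢
        by_cases hu : u ∈ K
        · simpa [hu] using (hin u hu w).1.1 h
        · simpa [hu] using (hout u hu w).1.1 h
      · rintro ⟨u, w⟩ h
        simp only [coe_filter, mem_univ, true_and, Set.mem_ofPred_eq] at h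
        have := hK u w h
        by_cases hu : u ∈ K
        · simp [hu, this.1 hu]
        · simp [hu]
      · rintro ⟨u, w⟩ h
        simp only [coe_filter, mem_univ, true_and, Set.mem_ofPred_eq] at h
        by_cases hu : u ∈ K
        · have := (hK w u ((hin u hu w).1.1 h)).2 hu
          simp [hu, this]
        · simp [hu]
    omega
  have hmin' : IsMinZeroForcing T (sources D') :=
    ⟨hsys.isZeroForcing_sources hT, hcard ▸ hmin.2⟩
  refine ⟨D', K, hsys, ⟨hmin, hmin', ?_⟩, hbp, ?_, hin, hout⟩
  -- Only `b` can cease to be a source. Since the cardinalities agree, the symmetric difference has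
  -- 0 or 2 elements.
  · have hsub : sources D \ sources D' ⊆ {b} := by
      intro x hx
      rw [mem_sdiff, mem_sources, mem_sources] at hx
      obtain ⟨h1, h2⟩ := hx
      push Not at h2
      obtain ⟨u, hu⟩ := h2
      have hxK : x ∈ K := by
        by_contra hxK
        exact h1 u ((hout x hxK u).2.1 hu)
      rcases ReflTransGen.cases_tail hxK with rfl | ⟨c, -, hc⟩
      · exact mem_singleton_self _
      · exact (h1 c hc).elim
    have hle := card_le_card hsub
    rw [card_singleton] at hle
    have hsd : (symmDiff (sources D) (sources D')).card =
        (sources D \ sources D').card + (sources D' \ sources D).card := by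
      rw [symmDiff_def, sup_eq_union, card_union_of_disjoint]
      exact disjoint_sdiff_sdiff
    have h1 := card_sdiff_add_card_inter (sources D) (sources D')
    have h2 := card_sdiff_add_card_inter (sources D') (sources D)
    rw [inter_comm] at h2
    by_cases h0 : (sources D \ sources D').card = 0
    · have : sources D = sources D' := by
        refine eq_of_subset_of_card_le ?_ hcard.ge
        rwa [card_eq_zero, sdiff_eq_empty_iff_subset] at h0
      have e : (⟨sources D, hmin⟩ : {B : Finset V // IsMinZeroForcing T B}) =
        ⟨sources D', hmin'⟩ := Subtype.ext this
      rw [e]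
    · apply SimpleGraph.Adj.reachable
      change (symmDiff (sources D) (sources D')).card = 2
      omega
  · intro x hx
    exact (reflTransGen_link_symm (reflTransGen_link hbp)).trans (reflTransGen_link hx)

/-! ### Exchanging edges -/

section Forest

variable {T : SimpleGraph V} {D D' : V → V → Prop}

theorem link_ext (h : ∀ u w, Link D' u w ↔ Link D u w) :
    Link D' = Link D := by
  ext u w
  exact h u w

/-- An edge of a forest is a bridge, so an unused edge joins different paths. Hence the path through
`p` can be reversed without disturbing `l`. -/
theorem IsPathSystem.not_reflTransGen_link (hT : T.IsAcyclic) (hD : IsPathSystem T D) {l p : V}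
    (hlp : T.Adj l p) (h : ¬ Link D l p) : ¬ ReflTransGen (Link D) l p := by
  intro hr
  have hb := SimpleGraph.isBridge_iff.1 (SimpleGraph.isAcyclic_iff_forall_adj_isBridge.1 hT hlp)
  apply hb
  rw [SimpleGraph.reachable_iff_reflTransGen]
  refine ReflTransGen.mono (fun u w huw => ?_) _ _ hr
  rw [SimpleGraph.deleteEdges_adj]
  refine ⟨huw.elim (fun h => hD.adj h) (fun h => (hD.adj h).symm), fun he => h ?_⟩
  rcases Sym2.eq_iff.1 (Set.mem_singleton_iff.1 he) with ⟨rfl, rfl⟩ | ⟨rfl, rfl⟩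
  · exact huw
  · exact huw.symm

theorem IsPathSystem.link_pigeonhole (hD : IsPathSystem T D) {p a b c : V} (ha : Link D p a)
    (hb : Link D p b) (hc : Link D p c) : a = b ∨ b = c ∨ a = c := by
  rcases ha with ha | ha <;> rcases hb with hb | hb <;> rcases hc with hc | hc <;>
    first
    | exact Or.inl (hD.out_unique ha hb)
    | exact Or.inl (hD.in_unique ha hb)
    | exact Or.inr (Or.inl (hD.out_unique hb hc))
    | exact Or.inr (Or.inl (hD.in_unique hb hc))
    | exact Or.inr (Or.inr (hD.out_unique ha hc))
    | exact Or.inr (Or.inr (hD.in_unique ha hc))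

theorem IsPathSystem.add (hD : IsPathSystem T D) {l p : V} (hlp : T.Adj l p)
    (hl : ∀ y, ¬ D l y) (hp : ∀ y, ¬ D y p) (hpl : ¬ D p l) :
    IsPathSystem T fun a b => D a b ∨ (a = l ∧ b = p) := by
  refine ⟨?_, ?_, ?_, ?_⟩
  · rintro a b (h | ⟨rfl, rfl⟩)
    exacts [hD.adj h, hlp]
  · rintro a b c (h | ⟨rfl, rfl⟩) (h' | ⟨h1, h2⟩)
    · exact hD.out_unique h h'
    · exact (hl b (h1 ▸ h)).elim
    · exact (hl c h').elim
    · exact h2.symm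
  · rintro a b c (h | ⟨rfl, rfl⟩) (h' | ⟨h1, h2⟩)
    · exact hD.in_unique h h'
    · exact (hp a (h2 ▸ h)).elim
    · exact (hp b h').elim
    · exact h1.symm
  · rintro a b (h | ⟨rfl, rfl⟩) (h' | ⟨h1, h2⟩)
    · exact hD.asymm h h'
    · exact hpl (h1 ▸ h2 ▸ h)
    · exact hpl h'
    · exact hlp.ne h2

theorem IsPathSystem.remove (hD : IsPathSystem T D) (q p : V) :
    IsPathSystem T fun a b => D a b ∧ ¬ (a = q ∧ b = p) :=
  ⟨fun h => hD.adj h.1, fun h h' => hD.out_unique h.1 h'.1, fun h h' => hD.in_unique h.1 h'.1,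
    fun h h' => hD.asymm h.1 h'.1⟩

variable [Fintype V]

open Classical in
/-- The darts of the edges that belong to exactly one of two path systems. -/
noncomputable def diffDarts (D D' : V → V → Prop) : Finset (V × V) :=
  univ.filter fun e => ¬ (Link D e.1 e.2 ↔ Link D' e.1 e.2)

theorem mem_diffDarts {u w : V} : (u, w) ∈ diffDarts D D' ↔ ¬ (Link D u w ↔ Link D' u w) := by
  simp [diffDarts]

theorem diffDarts_comm : diffDarts D D' = diffDarts D' D := by
  ext ⟨u, w⟩
  rw [mem_diffDarts, mem_diffDarts, iff_comm (a := Link D u w)]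

variable [DecidableEq V]

theorem Conn.refl {B : Finset V} (h : IsMinZeroForcing T B) : Conn T B B := ⟨h, h, .rfl⟩

theorem Conn.symm {B B' : Finset V} (h : Conn T B B') : Conn T B' B := by
  obtain ⟨h1, h2, h⟩ := h
  exact ⟨h2, h1, h.symm⟩

theorem Conn.trans {B B' B'' : Finset V} (h : Conn T B B') (h' : Conn T B' B'') :
    Conn T B B'' := by
  obtain ⟨h1, h2, h⟩ := h
  obtain ⟨h3, h4, h'⟩ := h'
  exact ⟨h1, h4, h.trans h'⟩

theorem Conn.isMin_right {B B' : Finset V} (h : Conn T B B') : IsMinZeroForcing T B' := h.2.1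

/-- Reversing the path through `p` changes no undirected edge and nothing away from that path. -/
theorem IsPathSystem.exists_reverse (hT : T.IsAcyclic) (hD : IsPathSystem T D)
    (hmin : IsMinZeroForcing T (sources D)) (p : V) :
    ∃ D' : V → V → Prop, IsPathSystem T D' ∧ Conn T (sources D) (sources D') ∧
      (∀ u w, Link D' u w ↔ Link D u w) ∧
      (∀ y, (D' p y ↔ D y p) ∧ (D' y p ↔ D p y)) ∧
      (∀ x, ¬ ReflTransGen (Link D) p x → ∀ y, (D' x y ↔ D x y) ∧ (D' y x ↔ D y x)) := by
  obtain ⟨D', K, hD', hconn, hp, hK, hin, hout⟩ := hD.exists_flip hT hmin p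
  refine ⟨D', hD', hconn, fun u w => ?_, hin p hp, fun x hx => hout x fun h => hx (hK x h)⟩
  by_cases hu : u ∈ K
  · rw [Link, Link, (hin u hu w).1, (hin u hu w).2, or_comm]
  · rw [Link, Link, (hout u hu w).1, (hout u hu w).2]

/-- An endpoint of a path can be made its final vertex. -/
theorem IsPathSystem.exists_orient_end (hT : T.IsAcyclic) (hD : IsPathSystem T D)
    (hmin : IsMinZeroForcing T (sources D)) {l : V}
    (hl : ∀ a c, Link D l a → Link D l c → a = c) :
    ∃ D' : V → V → Prop, IsPathSystem T D' ∧ Conn T (sources D) (sources D') ∧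
      Link D' = Link D ∧ ∀ y, ¬ D' l y := by
  by_cases h : ∃ y, D l y
  · obtain ⟨y, hy⟩ := h
    obtain ⟨D', hD', hconn, hlink, hrev, -⟩ := hD.exists_reverse hT hmin l
    refine ⟨D', hD', hconn, link_ext hlink, fun z hz => ?_⟩
    have hz' := (hrev z).1.1 hz
    have := hl y z (Or.inl hy) (Or.inr hz')
    subst this
    exact hD.asymm hy hz'
  · push Not at h
    exact ⟨D, hD, .refl hmin, rfl, h⟩

/-- If an endpoint `l` of a path is joined in `T` to `p` by an unused edge, then `p` is an interior
vertex of a path, provided that the number of paths is minimum. -/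
theorem IsPathSystem.exists_two_links (hT : T.IsAcyclic) (hD : IsPathSystem T D)
    (hmin : IsMinZeroForcing T (sources D)) {l p : V} (hlp : T.Adj l p) (hnl : ¬ Link D l p)
    (hl : ∀ a c, Link D l a → Link D l c → a = c) :
    ∃ a c, Link D p a ∧ Link D p c ∧ a ≠ c := by
  by_contra! hp
  obtain ⟨D₁, hD₁, hconn₁, hlink₁, hl₁⟩ := hD.exists_orient_end hT hmin hl
  obtain ⟨D₂, hD₂, hconn₂, hlink₂, hl₂, hp₂⟩ : ∃ D₂ : V → V → Prop, IsPathSystem T D₂ ∧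
      Conn T (sources D₁) (sources D₂) ∧ Link D₂ = Link D ∧ (∀ y, ¬ D₂ l y) ∧
      ∀ y, ¬ D₂ y p := by
    by_cases h : ∃ y, D₁ y p
    · obtain ⟨y, hy⟩ := h
      obtain ⟨D₂, hD₂, hconn, hlink, hrev, hout⟩ := hD₁.exists_reverse hT hconn₁.isMin_right p
      have hr : ¬ ReflTransGen (Link D₁) p l := fun h =>
        hD.not_reflTransGen_link hT hlp hnl (hlink₁ ▸ reflTransGen_link_symm h)
      refine ⟨D₂, hD₂, hconn, (link_ext hlink).trans hlink₁,
        fun z hz => hl₁ z ((hout l hr z).1.1 hz), fun z hz => ?_⟩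
      have hz' := (hrev z).2.1 hz
      have := hp y z (hlink₁ ▸ Or.inr hy) (hlink₁ ▸ Or.inl hz')
      subst this
      exact hD₁.asymm hy hz'
    · push Not at h
      exact ⟨D₁, hD₁, .refl hconn₁.isMin_right, hlink₁, hl₁, h⟩
  -- Joining the two paths by `l → p` would remove the source `p`, against minimality.
  have hadd := hD₂.add hlp hl₂ hp₂ fun h => hnl (hlink₂ ▸ Or.inr h)
  have hle := zeroForcingNumber_le (hadd.isZeroForcing_sources hT)
  rw [← hconn₂.isMin_right.2] at hle
  refine hle.not_gt (card_lt_card ?_)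
  rw [ssubset_iff_of_subset]
  · refine ⟨p, mem_sources.2 hp₂, fun h => mem_sources.1 h l (Or.inr ⟨rfl, rfl⟩)⟩
  · intro x hx
    rw [mem_sources] at hx ⊢
    exact fun u hu => hx u (Or.inl hu)

/-- Exchanging the edge `pq` for the edge `lp`. -/
theorem IsPathSystem.exists_exchange (hT : T.IsAcyclic) (hD : IsPathSystem T D)
    (hmin : IsMinZeroForcing T (sources D)) {l p q : V} (hlp : T.Adj l p) (hnl : ¬ Link D l p)
    (hl : ∀ a c, Link D l a → Link D l c → a = c) (hpq : Link D p q) :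
    ∃ D' : V → V → Prop, IsPathSystem T D' ∧ Conn T (sources D) (sources D') ∧
      ∀ u w, Link D' u w ↔ (Link D u w ∧ s(u, w) ≠ s(p, q)) ∨ s(u, w) = s(l, p) := by
  obtain ⟨D₁, hD₁, hconn₁, hlink₁, hl₁⟩ := hD.exists_orient_end hT hmin hl
  obtain ⟨D₂, hD₂, hconn₂, hlink₂, hl₂, hqp⟩ : ∃ D₂ : V → V → Prop, IsPathSystem T D₂ ∧
      Conn T (sources D₁) (sources D₂) ∧ Link D₂ = Link D ∧ (∀ y, ¬ D₂ l y) ∧ D₂ q p := by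
    rw [← hlink₁] at hpq
    rcases hpq with h | h
    · obtain ⟨D₂, hD₂, hconn, hlink, hrev, hout⟩ := hD₁.exists_reverse hT hconn₁.isMin_right p
      have hr : ¬ ReflTransGen (Link D₁) p l := fun h =>
        hD.not_reflTransGen_link hT hlp hnl (hlink₁ ▸ reflTransGen_link_symm h)
      exact ⟨D₂, hD₂, hconn, (link_ext hlink).trans hlink₁,
        fun z hz => hl₁ z ((hout l hr z).1.1 hz), (hrev q).2.2 h⟩
    · exact ⟨D₁, hD₁, .refl hconn₁.isMin_right, hlink₁, hl₁, h⟩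
  have hsys := (hD₂.remove q p).add hlp (fun y h => hl₂ y h.1)
    (fun y h => h.2 ⟨hD₂.in_unique h.1 hqp, rfl⟩) fun h => hnl (hlink₂ ▸ Or.inr h.1)
  refine ⟨_, hsys, ?_, fun u w => ?_⟩
  -- The sources are unchanged: `p` merely has predecessor `l` instead of `q`.
  · convert hconn₁.trans hconn₂ using 1
    ext x
    simp only [mem_sources]
    constructor
    · intro h u hu
      by_cases hup : u = q ∧ x = p
      · exact h l (Or.inr ⟨rfl, hup.2⟩)
      · exact h u (Or.inl ⟨hu, hup⟩)
    · rintro h u (hu | ⟨rfl, rfl⟩)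
      · exact h u hu.1
      · exact h q hqp
  · have hne := hD₂.asymm hqp
    rw [← hlink₂]
    simp only [Link, Ne, Sym2.eq_iff]
    constructor
    · rintro ((⟨h1, h2⟩ | ⟨rfl, rfl⟩) | (⟨h1, h2⟩ | ⟨rfl, rfl⟩))
      · refine Or.inl ⟨Or.inl h1, ?_⟩
        rintro (⟨rfl, rfl⟩ | h)
        exacts [hne h1, h2 h]
      · exact Or.inr (Or.inl ⟨rfl, rfl⟩)
      · refine Or.inl ⟨Or.inr h1, ?_⟩
        rintro (⟨rfl, rfl⟩ | ⟨rfl, rfl⟩)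
        exacts [h2 ⟨rfl, rfl⟩, hne h1]
      · exact Or.inr (Or.inr ⟨rfl, rfl⟩)
    · rintro (⟨h1 | h1, h2⟩ | (⟨rfl, rfl⟩ | ⟨rfl, rfl⟩))
      · exact Or.inl (Or.inl ⟨h1, fun h => h2 (Or.inr h)⟩)
      · exact Or.inr (Or.inl ⟨h1, fun h => h2 (Or.inl h.symm)⟩)
      · exact Or.inl (Or.inr ⟨rfl, rfl⟩)
      · exact Or.inr (Or.inr ⟨rfl, rfl⟩)

/-- At the leaf `l` every edge of `D` is also in `D'`, which has `lp` besides; as `D'` has degree at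
most 2, `l` is an endpoint in `D`. The exchange then removes both `lp` and `pq` from the difference.
-/
theorem IsPathSystem.exists_diffDarts_lt (hT : T.IsAcyclic) (hD : IsPathSystem T D)
    (hmin : IsMinZeroForcing T (sources D)) (hD' : IsPathSystem T D') {l p : V}
    (hnl : ¬ Link D l p) (hl' : Link D' l p)
    (hleaf : ∀ w, (l, w) ∈ diffDarts D D' → w = p) :
    ∃ D₁ : V → V → Prop, IsPathSystem T D₁ ∧ Conn T (sources D) (sources D₁) ∧
      (diffDarts D₁ D').card < (diffDarts D D').card := by
  have hlp : T.Adj l p := hl'.elim (fun h => hD'.adj h) fun h => (hD'.adj h).symm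
  have htrans : ∀ a, Link D l a → a ≠ p ∧ Link D' l a := by
    intro a ha
    have hap : a ≠ p := by
      rintro rfl
      exact hnl ha
    refine ⟨hap, ?_⟩
    by_contra h
    exact hap (hleaf a (mem_diffDarts.2 fun hi => h (hi.1 ha)))
  have hl : ∀ a c, Link D l a → Link D l c → a = c := by
    intro a c ha hc
    obtain ⟨hap, ha'⟩ := htrans a ha
    obtain ⟨hcp, hc'⟩ := htrans c hc
    rcases hD'.link_pigeonhole ha' hc' hl' with h | h | h
    exacts [h, (hcp h).elim, (hap h).elim]
  obtain ⟨q, hpq, hpq'⟩ : ∃ q, Link D p q ∧ ¬ Link D' p q := by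
    obtain ⟨a, c, ha, hc, hac⟩ := hD.exists_two_links hT hmin hlp hnl hl
    by_contra! h
    rcases hD'.link_pigeonhole (h a ha) (h c hc) hl'.symm with e | rfl | rfl
    exacts [hac e, hnl hc.symm, hnl ha.symm]
  obtain ⟨D₁, hD₁, hconn, hlink⟩ := hD.exists_exchange hT hmin hlp hnl hl hpq
  refine ⟨D₁, hD₁, hconn, card_lt_card ?_⟩
  have hL : ∀ u w, s(u, w) = s(l, p) → Link D' u w := by
    intro u w h
    rcases Sym2.eq_iff.1 h with ⟨rfl, rfl⟩ | ⟨rfl, rfl⟩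
    exacts [hl', hl'.symm]
  have hQ : ∀ u w, s(u, w) = s(p, q) → ¬ Link D' u w := by
    intro u w h
    rcases Sym2.eq_iff.1 h with ⟨rfl, rfl⟩ | ⟨rfl, rfl⟩
    exacts [hpq', fun h => hpq' h.symm]
  rw [ssubset_iff_of_subset]
  · refine ⟨(l, p), mem_diffDarts.2 fun h => hnl (h.2 hl'), fun h => ?_⟩
    rw [mem_diffDarts, hlink] at h
    exact h ⟨fun _ => hl', fun _ => Or.inr rfl⟩
  · rintro ⟨u, w⟩ h
    rw [mem_diffDarts, hlink] at h
    rw [mem_diffDarts]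
    intro hi
    have h1 := hL u w
    have h2 := hQ u w
    tauto

/-! ### Connecting any two path systems -/

/-- Two orientations of the same paths give connected zero forcing sets. -/
theorem IsPathSystem.conn_of_link_eq (hT : T.IsAcyclic) (hD' : IsPathSystem T D') :
    ∀ (n : ℕ) (D : V → V → Prop), IsPathSystem T D → IsMinZeroForcing T (sources D) →
      (∀ u w, Link D u w ↔ Link D' u w) →
      {e : V × V | D e.1 e.2 ∧ ¬ D' e.1 e.2}.ncard = n → Conn T (sources D) (sources D') := by
  intro n
  induction n using Nat.strong_induction_on with
  | _ n ih =>
    intro D hD hmin hlink hn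
    by_cases hsub : ∀ u w, D u w → D' u w
    · have : D = D' := by
        ext u w
        refine ⟨hsub u w, fun h => ?_⟩
        rcases (hlink u w).2 (Or.inl h) with h' | h'
        exacts [h', (hD'.asymm h (hsub w u h')).elim]
      subst this
      exact .refl hmin
    · push Not at hsub
      obtain ⟨p, p', hp, hp'⟩ := hsub
      have hopp : ∀ u w, D u w → ¬ D' u w → D' w u := fun u w h h' =>
        ((hlink u w).1 (Or.inl h)).resolve_left h'
      obtain ⟨D₁, K, hD₁, hconn, hpK, hK, hin, hout⟩ := hD.exists_flip hT hmin p
      -- One oppositely oriented edge forces the whole path to be opposite, by uniqueness of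
      -- successors and predecessors. So the reversed path agrees with `D'`.
      have hrev : ∀ x ∈ K, ∀ y, (D x y → D' y x) ∧ (D y x → D' x y) := by
        intro x hx
        have hr := hK x hx
        clear hx
        induction hr with
        | refl =>
          have hp'p := hopp _ _ hp hp'
          refine fun y => ⟨fun h => hD.out_unique hp h ▸ hp'p, fun h => ?_⟩
          rcases (hlink y p).1 (Or.inl h) with h' | h'
          · rw [hD'.in_unique h' hp'p] at h
            exact (hD.asymm hp h).elim
          · exact h'
        | @tail a x _ hax ihx =>
          intro y
          rcases hax with hax | hax
          · have hxa := (ihx x).1 hax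
            refine ⟨fun h => ?_, fun h => hD.in_unique hax h ▸ hxa⟩
            rcases (hlink x y).1 (Or.inl h) with h' | h'
            · rw [hD'.out_unique h' hxa] at h
              exact (hD.asymm hax h).elim
            · exact h'
          · have hxa := (ihx x).2 hax
            refine ⟨fun h => hD.out_unique hax h ▸ hxa, fun h => ?_⟩
            rcases (hlink y x).1 (Or.inl h) with h' | h'
            · rw [hD'.in_unique h' hxa] at h
              exact (hD.asymm hax h).elim
            · exact h'
      refine hconn.trans (ih _ ?_ D₁ hD₁ hconn.isMin_right (fun u w => ?_) rfl)
      · rw [← hn]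
        refine Set.ncard_lt_ncard ?_ (Set.toFinite _)
        rw [Set.ssubset_iff_of_subset]
        · exact ⟨(p, p'), ⟨hp, hp'⟩, fun h => hD.asymm hp ((hin p hpK p').1.1 h.1)⟩
        · rintro ⟨u, w⟩ ⟨h1, h2⟩
          by_cases hu : u ∈ K
          · exact (h2 ((hrev u hu w).2 ((hin u hu w).1.1 h1))).elim
          · exact ⟨(hout u hu w).1.1 h1, h2⟩
      · rw [← hlink]
        by_cases hu : u ∈ K
        · rw [Link, Link, (hin u hu w).1, (hin u hu w).2, or_comm]
        · rw [Link, Link, (hout u hu w).1, (hout u hu w).2]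

theorem IsPathSystem.conn (hT : T.IsAcyclic) :
    ∀ (n : ℕ) (D D' : V → V → Prop), IsPathSystem T D → IsPathSystem T D' →
      IsMinZeroForcing T (sources D) → IsMinZeroForcing T (sources D') →
      (diffDarts D D').card = n → Conn T (sources D) (sources D') := by
  intro n
  induction n using Nat.strong_induction_on with
  | _ n ih =>
    intro D D' hD hD' hmin hmin' hn
    by_cases hlink : ∀ u w, Link D u w ↔ Link D' u w
    · exact hD'.conn_of_link_eq hT _ D hD hmin hlink rfl
    push Not at hlink
    obtain ⟨u₀, w₀, h₀⟩ := hlink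
    have h₀ : (u₀, w₀) ∈ diffDarts D D' := mem_diffDarts.2 (by tauto)
    -- A leaf of the difference exists, as otherwise every dart could be continued without
    -- backtracking.
    obtain ⟨p, l, hpl, hleaf⟩ : ∃ p l, (p, l) ∈ diffDarts D D' ∧
        ∀ w, (l, w) ∈ diffDarts D D' → w = p := by
      by_contra! h
      refine not_of_nonbacktracking hT (S := fun u w => (u, w) ∈ diffDarts D D') ?_
        (fun u v huv => h u v huv) u₀ w₀ h₀
      intro u w huw
      rw [mem_diffDarts] at huw
      have h1 : Link D u w → T.Adj u w := fun h => h.elim (fun h => hD.adj h)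
        fun h => (hD.adj h).symm
      have h2 : Link D' u w → T.Adj u w := fun h => h.elim (fun h => hD'.adj h)
        fun h => (hD'.adj h).symm
      tauto
    rw [mem_diffDarts] at hpl
    -- The exchange is made in whichever system lacks the edge `lp`.
    by_cases hl : Link D l p
    · have hl' : ¬ Link D' l p := fun h => hpl ⟨fun _ => h.symm, fun _ => hl.symm⟩
      obtain ⟨D₁, hD₁, hconn, hlt⟩ := hD'.exists_diffDarts_lt hT hmin' hD hl' hl
        (by rwa [diffDarts_comm])
      rw [diffDarts_comm, diffDarts_comm (D := D'), hn] at hlt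
      exact (ih _ hlt D D₁ hD hD₁ hmin hconn.isMin_right rfl).trans hconn.symm
    · have hl' : Link D' l p := by
        by_contra h
        exact hpl ⟨fun h' => (hl h'.symm).elim, fun h' => (h h'.symm).elim⟩
      obtain ⟨D₁, hD₁, hconn, hlt⟩ := hD.exists_diffDarts_lt hT hmin hD' hl hl' hleaf
      rw [hn] at hlt
      exact hconn.trans (ih _ hlt D₁ D' hD₁ hD' hconn.isMin_right hmin' rfl)

theorem connected_zeroForcingGraph (hT : T.IsAcyclic) : (zeroForcingGraph T).Connected := by
  obtain ⟨B₀, hB₀⟩ := exists_isMinZeroForcing T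
  refine (SimpleGraph.connected_iff _).2 ⟨?_, ⟨⟨B₀, hB₀⟩⟩⟩
  rintro ⟨B, hB⟩ ⟨B', hB'⟩
  obtain ⟨D, hD, rfl⟩ := hB.1.exists_isPathSystem
  obtain ⟨D', hD', rfl⟩ := hB'.1.exists_isPathSystem
  exact (IsPathSystem.conn hT _ D D' hD hD' hB hB' rfl).2.2

end Forest

end ZeroForcing

theorem mainTheorem1 :
    (∀ (V : Type*) [Fintype V] [DecidableEq V] (T : SimpleGraph V),
      T.IsTree → (ZeroForcing.zeroForcingGraph T).Connected) ∧
    (∀ (V : Type*) [Fintype V] [DecidableEq V] (T : SimpleGraph V),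
      T.IsAcyclic → (ZeroForcing.zeroForcingGraph T).Connected) ∧
    (∀ (V W : Type*) [Fintype V] [DecidableEq V] [Fintype W] [DecidableEq W]
      (G : SimpleGraph V) (H : SimpleGraph W),
      ∃ φ : (ZeroForcing.zeroForcingGraph G).boxProd (ZeroForcing.zeroForcingGraph H) ≃g
          ZeroForcing.zeroForcingGraph (SimpleGraph.sum G H),
        ∀ X Y, (φ (X, Y)).1 = X.1.disjSum Y.1) :=
  ⟨fun _ _ _ _ hT => ZeroForcing.connected_zeroForcingGraph hT.isAcyclic,
    fun _ _ _ _ hT => ZeroForcing.connected_zeroForcingGraph hT,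
    fun _ _ _ _ _ _ G H => ⟨ZeroForcing.sumIso G H, fun _ _ => rfl⟩⟩
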